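/- **Theorem 5.1.** Let $d\in\{1,2,3\}$, let $\mathcal D\subset\mathbb R^d$ be a non-empty bounded convex open set, and let $\mathcal T_h$ be a triangulation of $\mathcal D$, i.e. a finite simplicial complex whose union is $\overline{\mathcal D}$ (so $\partial\mathcal D$ is polygonal). Let $V_h\subset L_2(\mathcal D)$ be the space of continuous functions on $\overline{\mathcal D}$ that are affine on every simplex of $\mathcal T_h$ and vanish on $\partial\mathcal D$, let $\mathcal P_h:L_2(\mathcal D)\to V_h$ be the $L_2(\mathcal D)$-orthogonal projector, and let $\Lambda_h:V_h\to V_h$ be the discrete Laplacian, defined by $$(\Lambda_h v_h,w_h)_{L_2(\mathcal D)}=(\nabla v_h,\nabla w_h)_{L_2(\mathcal D)}\qquad\text{for all } v_h,w_h\in V_h .$$ The power $\Lambda_h^{1/2}$ is taken in the spectral sense. On $V_h\times V_h$ let $$A_h=\begin{bmatrix}0&I\\-\Lambda_h&0\end{bmatrix},\qquad E_h(t)=e^{tA_h},\qquad \mathcal P_hB=\begin{bmatrix}0\\ \mathcal P_h\end{bmatrix}.$$ Let $Q$ be a bounded self-adjoint positive semidefinite operator on $L_2(\mathcal D)$, and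 let $W$ be a (possibly cylindrical) $Q$-Wiener process on $L_2(\mathcal D)$ with respect to a filtration $\{\mathcal F_t\}_{t\ge0}$ on a probability space $(\Omega,\mathcal F,\mathbb P)$: the real random variables $(W(t),\varphi)$, $\varphi\in L_2(\mathcal D)$, are a.s. linear in $\varphi$, a.s. continuous in $t$ for each $\varphi$, vanish a.s. at $t=0$, are $\mathcal F_t$-measurable, and for $0\le s\le t$ the increments $(W(t)-W(s),\varphi)$ have law $\mathcal N\big(0,(t-s)(Q\varphi,\varphi)_{L_2(\mathcal D)}\big)$ and, jointly over all $\varphi$, are independent of $\mathcal F_s$. Let $u_{h,0},v_{h,0}\in L_2(\Omega,V_h)$ be $\mathcal F_0$-measurable (up to null sets), and let $X_h=[u_{h,1},u_{h,2}]^T$ be the exact solution of the finite element semidiscretisation of the stochastic wave equation, i.e., for each $t\ge0$, almost surely, $$X_h(t)=E_h(t)\begin{bmatrix}u_{h,0}\\v_{h,0}\end{bmatrix}+\int_0^tE_h(t-s)\mathcal P_hB\,\mathrm dW(s).$$ Then $\mathcal P_hQ\mathcal P_h$ is of trace class on $L_2(\mathcal D)$, the energies below are integrable, and for all $t\ge0$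 $$\mathbb E\Big[\tfrac12\big(\|\Lambda_h^{1/2}u_{h,1}(t)\|_{L_2(\mathcal D)}^2+\|u_{h,2}(t)\|_{L_2(\mathcal D)}^2\big)\Big] =\mathbb E\Big[\tfrac12\big(\|\Lambda_h^{1/2}u_{h,0}\|_{L_2(\mathcal D)}^2+\|v_{h,0}\|_{L_2(\mathcal D)}^2\big)\Big]+\tfrac12\,t\,\mathrm{Tr}(\mathcal P_hQ\mathcal P_h).$$ -/

import Mathlib

open MeasureTheory ProbabilityTheory TopologicalSpace Filter Topology
open scoped ENNReal NNReal RealInnerProductSpace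

noncomputable section

namespace StochWave

/-! ### The first order form of a second order system -/

section System

variable {V : Type*} [NormedAddCommGroup V] [NormedSpace ℝ V]

/-- The block operator `A = [[0, I], [-L, 0]]` on `V × V`. -/
def waveSystem (L : V →L[ℝ] V) : V × V →L[ℝ] V × V :=
  (ContinuousLinearMap.snd ℝ V V).prod (-(L ∘L ContinuousLinearMap.fst ℝ V V))

/-- The semigroup `E(t) = exp(t A)` generated by `A = [[0, I], [-L, 0]]`. -/
def waveSemigroup (L : V →L[ℝ] V) (t : ℝ) : V × V →L[ℝ] V × V :=
  NormedSpace.exp (t • waveSystem L)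

end System

/-! ### Triangulations and the piecewise linear finite element space -/

/-- A (conforming) triangulation of the open set `D ⊆ ℝᵈ`: a finite simplicial complex whose
underlying space is the closure of `D`. -/
structure Triangulation {d : ℕ} (D : Opens (EuclideanSpace ℝ (Fin d))) where
  /-- the simplices of the triangulation (given by their vertex sets), with all their faces -/
  complex : Geometry.SimplicialComplex ℝ (EuclideanSpace ℝ (Fin d))
  finite_faces : complex.faces.Finite
  space_eq : complex.space = closure (D : Set (EuclideanSpace ℝ (Fin d)))

/-- `L₂(D)`, with Lebesgue measure on `D`. -/
abbrev L2 {d : ℕ} (D : Opens (EuclideanSpace ℝ (Fin d))) : Type :=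
  Lp ℝ 2 ((volume : Measure (EuclideanSpace ℝ (Fin d))).restrict
    (D : Set (EuclideanSpace ℝ (Fin d))))

namespace Triangulation

variable {d : ℕ} {D : Opens (EuclideanSpace ℝ (Fin d))} (𝒯 : Triangulation D)

/-- Continuous functions that are affine on each simplex and vanish on `∂D`. They are
represented by their extension by zero to `ℝᵈ` (which is continuous since they vanish on `∂D`). -/
def feFunctions : Submodule ℝ (EuclideanSpace ℝ (Fin d) → ℝ) where
  carrier := {v | Continuous v ∧ (∀ x, x ∉ D → v x = 0) ∧
    ∀ s ∈ 𝒯.complex.faces, ∃ g : EuclideanSpace ℝ (Fin d) →ᵃ[ℝ] ℝ,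
      Set.EqOn v g (convexHull ℝ (s : Set (EuclideanSpace ℝ (Fin d))))}
  add_mem' := by
    rintro v w ⟨hv, hv0, hva⟩ ⟨hw, hw0, hwa⟩
    refine ⟨hv.add hw, fun x hx => by simp [hv0 x hx, hw0 x hx], fun s hs => ?_⟩
    obtain ⟨g, hg⟩ := hva s hs
    obtain ⟨g', hg'⟩ := hwa s hs
    exact ⟨g + g', fun x hx => by simp [hg hx, hg' hx]⟩
  zero_mem' := ⟨continuous_const, fun _ _ => rfl, fun _ _ => ⟨0, fun _ _ => rfl⟩⟩
  smul_mem' := by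
    rintro c v ⟨hv, hv0, hva⟩
    refine ⟨hv.const_smul c, fun x hx => by simp [hv0 x hx], fun s hs => ?_⟩
    obtain ⟨g, hg⟩ := hva s hs
    exact ⟨c • g, fun x hx => by simp [hg hx]⟩

theorem isCompact_space : IsCompact 𝒯.complex.space :=
  𝒯.finite_faces.isCompact_biUnion fun s _ => s.finite_toSet.isCompact_convexHull ℝ

theorem subset_space : (D : Set (EuclideanSpace ℝ (Fin d))) ⊆ 𝒯.complex.space := by
  rw [𝒯.space_eq]; exact subset_closure

theorem memLp_feFunctions (v : 𝒯.feFunctions) :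
    MemLp (v : EuclideanSpace ℝ (Fin d) → ℝ) 2 (volume.restrict
      (D : Set (EuclideanSpace ℝ (Fin d)))) := by
  apply v.2.1.memLp_of_hasCompactSupport
  exact HasCompactSupport.intro 𝒯.isCompact_space fun x hx =>
    v.2.2.1 x fun h => hx (𝒯.subset_space h)

/-- The class in `L₂(D)` of a finite element function. -/
def toL2 : 𝒯.feFunctions →ₗ[ℝ] L2 D where
  toFun v := (𝒯.memLp_feFunctions v).toLp _
  map_add' v w := MemLp.toLp_add (𝒯.memLp_feFunctions v) (𝒯.memLp_feFunctions w)
  map_smul' c v := MemLp.toLp_const_smul c (𝒯.memLp_feFunctions v)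

theorem toL2_injective : Function.Injective 𝒯.toL2 := by
  intro v w h
  have h1 := (MemLp.toLp_eq_toLp_iff (𝒯.memLp_feFunctions v) (𝒯.memLp_feFunctions w)).1 h
  have h2 := Measure.eqOn_open_of_ae_eq h1 D.isOpen v.2.1.continuousOn w.2.1.continuousOn
  ext x
  by_cases hx : x ∈ D
  · exact h2 hx
  · rw [v.2.2.1 x hx, w.2.2.1 x hx]

/-- The finite element space `V_h`, as a subspace of `L₂(D)`. -/
def Vh : Submodule ℝ (L2 D) := LinearMap.range 𝒯.toL2

/-- The elements of `V_h ⊆ L₂(D)` are the (unique) classes of finite element functions. -/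
def equivVh : 𝒯.feFunctions ≃ₗ[ℝ] 𝒯.Vh := LinearEquiv.ofInjective 𝒯.toL2 𝒯.toL2_injective

/-- The continuous piecewise linear function represented by an element of `V_h`. -/
def fn (v : 𝒯.Vh) : EuclideanSpace ℝ (Fin d) → ℝ := (𝒯.equivVh.symm v : 𝒯.feFunctions)

instance : FiniteDimensional ℝ 𝒯.Vh := by
  have hfin : Finite {s // s ∈ 𝒯.complex.faces} := 𝒯.finite_faces
  let F : 𝒯.feFunctions →ₗ[ℝ] ((Σ s : {s // s ∈ 𝒯.complex.faces}, s.1) → ℝ) :=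
    { toFun := fun v p => (v : EuclideanSpace ℝ (Fin d) → ℝ) p.2
      map_add' := fun _ _ => rfl
      map_smul' := fun _ _ => rfl }
  have hF : Function.Injective F := by
    rw [← LinearMap.ker_eq_bot, LinearMap.ker_eq_bot']
    intro v hv
    ext x
    by_cases hx : x ∈ D
    · have hx' := 𝒯.subset_space hx
      rw [Geometry.SimplicialComplex.mem_space_iff] at hx'
      obtain ⟨s, hs, hxs⟩ := hx'
      obtain ⟨g, hg⟩ := v.2.2.2 s hs
      rw [hg hxs]
      have hsub : (s : Set (EuclideanSpace ℝ (Fin d))) ⊆ g ⁻¹' {0} := fun y hy => by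
        have h1 := congrFun hv ⟨⟨s, hs⟩, ⟨y, hy⟩⟩
        have h2 := hg (subset_convexHull ℝ _ hy)
        rw [Set.mem_preimage, ← h2]
        exact h1
      exact convexHull_min hsub ((convex_singleton (0 : ℝ)).affine_preimage g) hxs
    · exact v.2.2.1 x hx
  have : FiniteDimensional ℝ 𝒯.feFunctions := FiniteDimensional.of_injective F hF
  exact LinearEquiv.finiteDimensional 𝒯.equivVh

/-! ### The discrete Laplacian -/

theorem fn_add (v w : 𝒯.Vh) : 𝒯.fn (v + w) = 𝒯.fn v + 𝒯.fn w := by simp [fn]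

theorem fn_smul (c : ℝ) (v : 𝒯.Vh) : 𝒯.fn (c • v) = c • 𝒯.fn v := by simp [fn]

/-- Finite element functions are almost everywhere differentiable, with gradient among the finitely
many gradients of their affine pieces. -/
theorem exists_bound_gradient (v : 𝒯.Vh) : ∃ C : ℝ, ∀ᵐ x ∂(volume : Measure
    (EuclideanSpace ℝ (Fin d))), DifferentiableAt ℝ (𝒯.fn v) x ∧ ‖gradient (𝒯.fn v) x‖ ≤ C := by
  obtain ⟨hc, h0, ha⟩ := (𝒯.equivVh.symm v).2
  change Continuous (𝒯.fn v) at hc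
  change ∀ x, x ∉ D → 𝒯.fn v x = 0 at h0
  change ∀ s ∈ 𝒯.complex.faces, ∃ g : EuclideanSpace ℝ (Fin d) →ᵃ[ℝ] ℝ,
      Set.EqOn (𝒯.fn v) g (convexHull ℝ (s : Set (EuclideanSpace ℝ (Fin d)))) at ha
  choose! g hg using ha
  refine ⟨∑ s ∈ 𝒯.finite_faces.toFinset,
    ‖LinearMap.toContinuousLinearMap (g s).linear‖, ?_⟩
  have hae : ∀ᵐ x ∂(volume : Measure (EuclideanSpace ℝ (Fin d))), ∀ s ∈ 𝒯.complex.faces,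
      x ∉ frontier (convexHull ℝ (s : Set (EuclideanSpace ℝ (Fin d)))) := by
    rw [ae_ball_iff 𝒯.finite_faces.countable]
    intro s _
    exact measure_eq_zero_iff_ae_notMem.1 ((convex_convexHull ℝ _).addHaar_frontier volume)
  filter_upwards [hae] with x hx
  have key : ∀ L : StrongDual ℝ (EuclideanSpace ℝ (Fin d)), HasFDerivAt (𝒯.fn v) L x →
      ‖L‖ ≤ ∑ s ∈ 𝒯.finite_faces.toFinset, ‖LinearMap.toContinuousLinearMap (g s).linear‖ →
      DifferentiableAt ℝ (𝒯.fn v) x ∧ ‖gradient (𝒯.fn v) x‖ ≤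
        ∑ s ∈ 𝒯.finite_faces.toFinset, ‖LinearMap.toContinuousLinearMap (g s).linear‖ := by
    intro L hL hb
    refine ⟨hL.differentiableAt, ?_⟩
    rw [gradient, LinearIsometryEquiv.norm_map, hL.fderiv]
    exact hb
  by_cases hxs : x ∈ 𝒯.complex.space
  · obtain ⟨s, hs, hxs⟩ := Geometry.SimplicialComplex.mem_space_iff.1 hxs
    have hint : x ∈ interior (convexHull ℝ (s : Set (EuclideanSpace ℝ (Fin d)))) := by
      by_contra hn
      exact hx s hs ⟨subset_closure hxs, hn⟩
    refine key (LinearMap.toContinuousLinearMap (g s).linear) ?_ ?_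
    · have h1 : HasFDerivAt (g s) (LinearMap.toContinuousLinearMap (g s).linear) x := by
        have h2 := ((LinearMap.toContinuousLinearMap (g s).linear).hasFDerivAt (x := x)).add_const
          (g s 0)
        refine h2.congr_of_eventuallyEq (Eventually.of_forall fun y => ?_)
        have := congrFun ((g s).decomp) y
        simpa using this
      refine h1.congr_of_eventuallyEq ?_
      filter_upwards [isOpen_interior.mem_nhds hint] with y hy
      exact hg s hs (interior_subset hy)
    · exact Finset.single_le_sum
        (f := fun s => ‖LinearMap.toContinuousLinearMap (g s).linear‖)
        (fun _ _ => norm_nonneg _) (𝒯.finite_faces.mem_toFinset.2 hs)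
  · refine key 0 ?_ (by simpa using Finset.sum_nonneg fun _ _ => norm_nonneg _)
    refine (hasFDerivAt_const (0 : ℝ) x).congr_of_eventuallyEq ?_
    filter_upwards [𝒯.isCompact_space.isClosed.isOpen_compl.mem_nhds hxs] with y hy
    exact h0 y fun h => hy (𝒯.subset_space h)

/-- The Dirichlet form `(∇v_h, ∇w_h)_{L₂(D)}` on `V_h`. -/
def dirichletForm (v w : 𝒯.Vh) : ℝ :=
  ∫ x in (D : Set (EuclideanSpace ℝ (Fin d))), ⟪gradient (𝒯.fn v) x, gradient (𝒯.fn w) x⟫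

theorem integrable_dirichletForm (v w : 𝒯.Vh) :
    Integrable (fun x => ⟪gradient (𝒯.fn v) x, gradient (𝒯.fn w) x⟫)
      (volume.restrict (D : Set (EuclideanSpace ℝ (Fin d)))) := by
  obtain ⟨C, hC⟩ := 𝒯.exists_bound_gradient v
  obtain ⟨C', hC'⟩ := 𝒯.exists_bound_gradient w
  have hm : ∀ v : 𝒯.Vh, Measurable (gradient (𝒯.fn v)) := fun v =>
    ((InnerProductSpace.toDual ℝ (EuclideanSpace ℝ (Fin d))).symm.continuous.measurable).comp
      (measurable_fderiv ℝ (𝒯.fn v))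
  have hfin : IsFiniteMeasure ((volume : Measure (EuclideanSpace ℝ (Fin d))).restrict
      (D : Set (EuclideanSpace ℝ (Fin d)))) :=
    ⟨by rw [Measure.restrict_apply_univ]
        exact (measure_mono 𝒯.subset_space).trans_lt 𝒯.isCompact_space.measure_lt_top⟩
  refine Integrable.of_bound ((hm v).inner (hm w)).aestronglyMeasurable (C * C') ?_
  filter_upwards [ae_restrict_of_ae hC, ae_restrict_of_ae hC'] with x hx hx'
  exact (norm_inner_le_norm _ _).trans
    (mul_le_mul hx.2 hx'.2 (norm_nonneg _) ((norm_nonneg _).trans hx.2))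

theorem dirichletForm_comm (v w : 𝒯.Vh) : 𝒯.dirichletForm v w = 𝒯.dirichletForm w v := by
  simp only [dirichletForm]
  congr 1 with x
  exact real_inner_comm _ _

theorem dirichletForm_add (v v' w : 𝒯.Vh) :
    𝒯.dirichletForm (v + v') w = 𝒯.dirichletForm v w + 𝒯.dirichletForm v' w := by
  rw [dirichletForm, dirichletForm, dirichletForm, ← integral_add
    (𝒯.integrable_dirichletForm v w) (𝒯.integrable_dirichletForm v' w)]
  obtain ⟨C, hC⟩ := 𝒯.exists_bound_gradient v
  obtain ⟨C', hC'⟩ := 𝒯.exists_bound_gradient v'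
  refine integral_congr_ae ?_
  filter_upwards [ae_restrict_of_ae hC, ae_restrict_of_ae hC'] with x hx hx'
  rw [← inner_add_left, fn_add]
  simp only [gradient]
  rw [fderiv_add hx.1 hx'.1, map_add]

theorem dirichletForm_smul (c : ℝ) (v w : 𝒯.Vh) :
    𝒯.dirichletForm (c • v) w = c * 𝒯.dirichletForm v w := by
  rw [dirichletForm, dirichletForm, ← integral_const_mul]
  obtain ⟨C, hC⟩ := 𝒯.exists_bound_gradient v
  refine integral_congr_ae ?_
  filter_upwards [ae_restrict_of_ae hC] with x hx
  rw [fn_smul, ← real_inner_smul_left]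
  simp only [gradient]
  rw [fderiv_const_smul hx.1, map_smul]

theorem exists_discreteLaplacian : ∃ L : 𝒯.Vh →ₗ[ℝ] 𝒯.Vh,
    ∀ v w : 𝒯.Vh, ⟪L v, w⟫ = 𝒯.dirichletForm v w := by
  let B : 𝒯.Vh →ₗ[ℝ] 𝒯.Vh →ₗ[ℝ] ℝ := LinearMap.mk₂ ℝ 𝒯.dirichletForm
    𝒯.dirichletForm_add 𝒯.dirichletForm_smul
    (fun v w w' => by
      rw [dirichletForm_comm, dirichletForm_add, dirichletForm_comm,
        dirichletForm_comm _ w'])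
    (fun c v w => by rw [dirichletForm_comm, dirichletForm_smul, dirichletForm_comm]; rfl)
  refine ⟨{ toFun := fun v => (InnerProductSpace.toDual ℝ 𝒯.Vh).symm
              (LinearMap.toContinuousLinearMap (B v))
            map_add' := fun v w => by simp
            map_smul' := fun c v => by simp }, fun v w => ?_⟩
  simp [B]

/-- The discrete Laplacian `Λ_h : V_h → V_h`, defined by
`(Λ_h v_h, w_h)_{L₂(D)} = (∇v_h, ∇w_h)_{L₂(D)}` for all `w_h ∈ V_h`
(see `inner_discreteLaplacian`; this identity determines it). -/
def discreteLaplacian : 𝒯.Vh →ₗ[ℝ] 𝒯.Vh := 𝒯.exists_discreteLaplacian.choose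

theorem inner_discreteLaplacian (v w : 𝒯.Vh) :
    ⟪𝒯.discreteLaplacian v, w⟫ =
      ∫ x in (D : Set (EuclideanSpace ℝ (Fin d))), ⟪gradient (𝒯.fn v) x, gradient (𝒯.fn w) x⟫ :=
  𝒯.exists_discreteLaplacian.choose_spec v w

theorem isSymmetric_discreteLaplacian : 𝒯.discreteLaplacian.IsSymmetric := by
  intro v w
  rw [real_inner_comm (𝒯.discreteLaplacian w) v, inner_discreteLaplacian, inner_discreteLaplacian]
  exact 𝒯.dirichletForm_comm v w

/-- The power `Λ_h^α`, through the eigenvalues `λ_i` and an orthonormal basis of eigenvectors `b_i`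
of `Λ_h`: `Λ_h^α v = ∑ i, λ_i^α (b_i, v) b_i`. -/
def discreteLaplacianPow (α : ℝ) (v : 𝒯.Vh) : 𝒯.Vh :=
  ∑ i, (𝒯.isSymmetric_discreteLaplacian.eigenvalues rfl i) ^ α •
    ⟪𝒯.isSymmetric_discreteLaplacian.eigenvectorBasis rfl i, v⟫ •
      𝒯.isSymmetric_discreteLaplacian.eigenvectorBasis rfl i

/-! ### The semidiscrete first order system -/

/-- The semigroup `E_h(t) = exp(t A_h)`. -/
def semigroup (t : ℝ) : 𝒯.Vh × 𝒯.Vh →L[ℝ] 𝒯.Vh × 𝒯.Vh :=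
  waveSemigroup (LinearMap.toContinuousLinearMap 𝒯.discreteLaplacian) t

/-- The operator `P_h B : L₂(D) → V_h × V_h`, `φ ↦ (0, P_h φ)`, with `P_h` the orthogonal
projection of `L₂(D)` onto `V_h`. -/
def noiseOp : L2 D →L[ℝ] 𝒯.Vh × 𝒯.Vh :=
  ContinuousLinearMap.inr ℝ 𝒯.Vh 𝒯.Vh ∘L 𝒯.Vh.orthogonalProjectionOnto

/-- The energy `½ (‖Λ_h^{1/2} u₁‖² + ‖u₂‖²)`, with norms of `L₂(D)`. -/
def energy (u : 𝒯.Vh × 𝒯.Vh) : ℝ :=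
  1 / 2 * (‖𝒯.discreteLaplacianPow (1 / 2) u.1‖ ^ 2 + ‖u.2‖ ^ 2)

end Triangulation

/-! ### `Q`-Wiener processes and the Wiener integral of deterministic integrands -/

section Wiener

variable {U : Type*} [NormedAddCommGroup U] [InnerProductSpace ℝ U]
  {Ω : Type*} {mΩ : MeasurableSpace Ω}

/-- A (possibly cylindrical) `Q`-Wiener process on the Hilbert space `U` with respect to the
filtration `ℱ`. The random variable `W t φ` is the pairing `(W(t), φ)_U`; for
`W(t) = ∑ⱼ γⱼ^{1/2} βⱼ(t) eⱼ` this is `∑ⱼ γⱼ^{1/2} βⱼ(t) (eⱼ, φ)_U`, a series which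
converges in `L₂(Ω)` also when `Q` is not of trace class (for instance for `Q = I`). -/
structure IsQWiener (Q : U →L[ℝ] U) (ℱ : Filtration ℝ≥0 mΩ) (P : Measure Ω)
    (W : ℝ≥0 → U → Ω → ℝ) : Prop where
  adapted : ∀ t φ, Measurable[ℱ t] (W t φ)
  ae_linear : ∀ t (a : ℝ) φ ψ, W t (a • φ + ψ) =ᵐ[P] fun ω => a * W t φ ω + W t ψ ω
  zero : ∀ φ, W 0 φ =ᵐ[P] 0
  continuous_paths : ∀ φ, ∀ᵐ ω ∂P, Continuous fun t => W t φ ω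
  law_increment : ∀ s t : ℝ≥0, s ≤ t → ∀ φ,
    HasLaw (fun ω => W t φ ω - W s φ ω)
      (gaussianReal 0 ((t - s) * Real.toNNReal ⟪Q φ, φ⟫)) P
  indep_increment : ∀ s t : ℝ≥0, s ≤ t →
    Indep (MeasurableSpace.comap (fun ω φ => W t φ ω - W s φ ω) MeasurableSpace.pi) (ℱ s) P

/-- A `U`-valued step function `∑ᵢ vᵢ 1_{(τᵢ, τᵢ₊₁]}` on `[0, t]`, with
`0 = τ₀ ≤ τ₁ ≤ ⋯ ≤ τₙ = t`. -/
structure StepFunction (U : Type*) (t : ℝ≥0) where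
  /-- number of intervals -/
  n : ℕ
  /-- partition points -/
  τ : Fin (n + 1) → ℝ≥0
  mono : Monotone τ
  τ_zero : τ 0 = 0
  τ_last : τ (Fin.last n) = t
  /-- values -/
  val : Fin n → U

namespace StepFunction

variable {t : ℝ≥0}

/-- The step function as a function of time. -/
def toFun (g : StepFunction U t) (s : ℝ) : U :=
  ∑ i, (Set.Ioc (g.τ i.castSucc : ℝ) (g.τ i.succ)).indicator (fun _ => g.val i) s

/-- The elementary integral `∑ᵢ (W(τᵢ₊₁) - W(τᵢ), vᵢ)`. -/
def wienerSum (g : StepFunction U t) (W : ℝ≥0 → U → Ω → ℝ) (ω : Ω) : ℝ :=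
  ∑ i, (W (g.τ i.succ) (g.val i) ω - W (g.τ i.castSucc) (g.val i) ω)

end StepFunction

/-- `I = ∫₀ᵗ (f(s), dW(s))`: `I` is the limit in `L₂(Ω)` of elementary integrals of step functions
`gₙ` which converge to `f` in the sense that `∫₀ᵗ ‖Q^{1/2}(gₙ(s) - f(s))‖² ds → 0`.
By the Itô isometry such an `I` does not depend, up to null sets, on the sequence. -/
def IsScalarWienerIntegral (Q : U →L[ℝ] U) (P : Measure Ω) (W : ℝ≥0 → U → Ω → ℝ) (t : ℝ≥0)
    (f : ℝ → U) (I : Ω → ℝ) : Prop :=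
  MemLp I 2 P ∧ ∃ g : ℕ → StepFunction U t,
    Tendsto (fun n => ∫⁻ s in Set.Ioc (0 : ℝ) t, ENNReal.ofReal
      ⟪Q ((g n).toFun s - f s), (g n).toFun s - f s⟫) atTop (𝓝 0) ∧
    Tendsto (fun n => eLpNorm (fun ω => (g n).wienerSum W ω - I ω) 2 P) atTop (𝓝 0)

/-- `I = ∫₀ᵗ Φ(s) dW(s)` for a deterministic `Φ : [0,t] → 𝓛(U, H)` with finite dimensional `H`:
for every linear functional `ℓ` on `H` one has `ℓ(I) = ∫₀ᵗ ℓ Φ(s) dW(s)`, where the functional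
`ℓ Φ(s)` on `U` is identified with an element of `U` by the Riesz isomorphism. -/
def IsWienerIntegral [CompleteSpace U] {H : Type*} [NormedAddCommGroup H] [NormedSpace ℝ H]
    [FiniteDimensional ℝ H] (Q : U →L[ℝ] U) (P : Measure Ω) (W : ℝ≥0 → U → Ω → ℝ) (t : ℝ≥0)
    (Φ : ℝ → U →L[ℝ] H) (I : Ω → H) : Prop :=
  ∀ ℓ : StrongDual ℝ H, IsScalarWienerIntegral Q P W t
    (fun s => (InnerProductSpace.toDual ℝ U).symm (ℓ ∘L Φ s)) (fun ω => ℓ (I ω))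

/-- `X` is given by the variation of constants formula
`X(t) = E_h(t) X₀ + ∫₀ᵗ E_h(t - s) P_h B dW(s)`, almost surely for each `t ≥ 0`: it is the exact
solution of the finite element semidiscretisation with initial value `X₀`. -/
def IsSemidiscreteSolution {d : ℕ} {D : Opens (EuclideanSpace ℝ (Fin d))} (𝒯 : Triangulation D)
    (Q : L2 D →L[ℝ] L2 D) (P : Measure Ω) (W : ℝ≥0 → L2 D → Ω → ℝ)
    (X₀ : Ω → 𝒯.Vh × 𝒯.Vh) (X : ℝ≥0 → Ω → 𝒯.Vh × 𝒯.Vh) : Prop :=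
  ∀ t : ℝ≥0, ∃ I : Ω → 𝒯.Vh × 𝒯.Vh,
    IsWienerIntegral Q P W t (fun s => 𝒯.semigroup (t - s) ∘L 𝒯.noiseOp) I ∧
    ∀ᵐ ω ∂P, X t ω = 𝒯.semigroup t (X₀ ω) + I ω

end Wiener

/-- `T` is of trace class with trace `τ`: for every orthonormal basis `e` of `U` the series
`∑ₖ (eₖ, T eₖ)` converges (unconditionally) to `τ`. (Every orthonormal basis can be indexed by
the set of its elements.) -/
def HasTrace {U : Type*} [NormedAddCommGroup U] [InnerProductSpace ℝ U] (T : U →L[ℝ] U)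
    (τ : ℝ) : Prop :=
  ∀ (w : Set U) (e : HilbertBasis w ℝ U), HasSum (fun k => ⟪e k, T (e k)⟫) τ

end StochWave

end

open StochWave

/-! In an orthonormal eigenbasis `e i` of the discrete Laplacian, the energy is half the sum over
`i` of `lam * x ^ 2 + y ^ 2`, with `x`, `y` the coordinates of displacement and velocity: a finite
family of decoupled oscillators. Let `f`, `g` be the two coordinate functionals composed with the
semigroup and sent by a linear map `Ψ` into an inner product space. Then `f' = g` and `g' = -lam f`,
so `lam * ⟪Q f, f⟫ + ⟪Q g, g⟫` is constant for every positive `Q` (`eigencoordinate_energy_const`).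

This conservation law is used twice. With `Ψ` evaluation at an initial value, the semigroup
preserves the energy (`energy_semigroup`). With `Ψ` the Riesz representative after the noise
operator, the Itô integrand of mode `i` keeps its value at time zero. Noise enters only the
velocity, so that value is `⟪Q (e i), e i⟫` (`noise_energy`); integrating over `[0, t]` and summing
over `i` gives `t` times the trace.

The probabilistic input is the Itô isometry (`integral_sq_eq`) and the vanishing of the correlation
between initial data and stochastic integral (`integral_mul_eq_zero`). Both are finite computations
for step functions, passed to the limit. -/

namespace StochWave

/-! ### Limits of integrals of quadratic quantities -/

/-- The bound has the shape that Young's inequality gives for squares, products and semidefinite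
forms, so one lemma serves the limits on `Ω` and those in time. First `ε` makes the `y` term small,
then `n` the `d` term. -/
theorem tendsto_integral_of_abs_sub_le {α : Type*} {mα : MeasurableSpace α} {μ : Measure α}
    {x d : ℕ → α → ℝ} {y z : α → ℝ} (hx : ∀ n, Integrable (x n) μ) (hz : Integrable z μ)
    (hd : ∀ n, Integrable (d n) μ) (hy : Integrable y μ)
    (h : ∀ ε : ℝ, 0 < ε → ∃ K : ℝ, ∀ n a, |x n a - z a| ≤ K * d n a + ε * y a)
    (hd0 : Tendsto (fun n => ∫ a, d n a ∂μ) atTop (𝓝 0)) :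
    Tendsto (fun n => ∫ a, x n a ∂μ) atTop (𝓝 (∫ a, z a ∂μ)) := by
  rw [Metric.tendsto_nhds]
  intro δ hδ
  have hY : 0 < 2 * (|∫ a, y a ∂μ| + 1) := by positivity
  -- With this `ε` the `y` term is at most `δ / 2`; the added 1 keeps the denominator positive when
  -- the integral of `y` vanishes.
  obtain ⟨K, hK⟩ := h (δ / (2 * (|∫ a, y a ∂μ| + 1))) (by positivity)
  have h0 : Tendsto (fun n => K * ∫ a, d n a ∂μ) atTop (𝓝 0) := by
    simpa using hd0.const_mul K
  filter_upwards [h0.eventually_lt_const (half_pos hδ)] with n hn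
  rw [Real.dist_eq, ← integral_sub (hx n) hz]
  have h1 : |∫ a, (x n a - z a) ∂μ| ≤
      K * (∫ a, d n a ∂μ) + δ / (2 * (|∫ a, y a ∂μ| + 1)) * ∫ a, y a ∂μ := by
    rw [← integral_const_mul, ← integral_const_mul,
      ← integral_add ((hd n).const_mul _) (hy.const_mul _)]
    exact abs_integral_le_integral_abs.trans (integral_mono ((hx n).sub hz).abs
      (((hd n).const_mul _).add (hy.const_mul _)) (hK n))
  have h2 : δ / (2 * (|∫ a, y a ∂μ| + 1)) * ∫ a, y a ∂μ ≤ δ / 2 := by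
    rw [div_mul_eq_mul_div, div_le_div_iff₀ hY two_pos]
    nlinarith [le_abs_self (∫ a, y a ∂μ)]
  linarith

theorem abs_mul_le_sq_add_sq {ε : ℝ} (hε : 0 < ε) (a b : ℝ) :
    |a * b| ≤ ε⁻¹ * b ^ 2 + ε * a ^ 2 := by
  have h1 : ε * ε⁻¹ = 1 := mul_inv_cancel₀ hε.ne'
  have h2 : 0 < ε⁻¹ := inv_pos.2 hε
  have h3 : 0 ≤ ε⁻¹ * (b - ε * a) ^ 2 := by positivity
  have h4 : 0 ≤ ε⁻¹ * (b + ε * a) ^ 2 := by positivity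
  have h5 : 0 ≤ ε⁻¹ * b ^ 2 + ε * a ^ 2 := by positivity
  have e3 : ε⁻¹ * (b - ε * a) ^ 2 = ε⁻¹ * b ^ 2 + ε * a ^ 2 - 2 * (a * b) := by
    field_simp; ring
  have e4 : ε⁻¹ * (b + ε * a) ^ 2 = ε⁻¹ * b ^ 2 + ε * a ^ 2 + 2 * (a * b) := by
    field_simp; ring
  rw [abs_le]
  constructor <;> linarith

/-- With `h = g - f` the difference is `2 * ⟪Q f, h⟫ + ⟪Q h, h⟫`. Nonnegativity of the form at `f ±
ε⁻¹ • h`, multiplied by `ε`, controls the cross term. No square root of `Q` is needed, and `Q` may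
be degenerate. -/
theorem abs_sub_quadratic_le {U : Type*} [NormedAddCommGroup U] [InnerProductSpace ℝ U]
    {Q : U →L[ℝ] U} (hQ : Q.IsPositive) {ε : ℝ} (hε : 0 < ε) (f g : U) :
    |⟪Q g, g⟫ - ⟪Q f, f⟫| ≤ (1 + ε⁻¹) * ⟪Q (g - f), g - f⟫ + ε * ⟪Q f, f⟫ := by
  obtain ⟨h, rfl⟩ : ∃ h, g = f + h := ⟨g - f, by abel⟩
  rw [add_sub_cancel_left]
  have hs : ⟪Q h, f⟫ = ⟪Q f, h⟫ := by
    rw [hQ.inner_left_eq_inner_right, real_inner_comm]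
  have hpos : ∀ c : ℝ, 0 ≤ ⟪Q f, f⟫ + 2 * c * ⟪Q f, h⟫ + c ^ 2 * ⟪Q h, h⟫ := fun c => by
    have := hQ.inner_nonneg_left (f + c • h)
    simp only [map_add, map_smul, inner_add_left, inner_add_right, real_inner_smul_left,
      real_inner_smul_right, hs] at this
    linarith
  have e : ⟪Q (f + h), f + h⟫ = ⟪Q f, f⟫ + 2 * ⟪Q f, h⟫ + ⟪Q h, h⟫ := by
    simp only [map_add, inner_add_left, inner_add_right, hs]
    ring
  have hh : 0 ≤ ⟪Q h, h⟫ := hQ.inner_nonneg_left h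
  have h1 := mul_nonneg hε.le (hpos ε⁻¹)
  have h2 := mul_nonneg hε.le (hpos (-ε⁻¹))
  have e1 : ε * (⟪Q f, f⟫ + 2 * ε⁻¹ * ⟪Q f, h⟫ + ε⁻¹ ^ 2 * ⟪Q h, h⟫) =
      ε * ⟪Q f, f⟫ + 2 * ⟪Q f, h⟫ + ε⁻¹ * ⟪Q h, h⟫ := by field_simp
  have e2 : ε * (⟪Q f, f⟫ + 2 * -ε⁻¹ * ⟪Q f, h⟫ + (-ε⁻¹) ^ 2 * ⟪Q h, h⟫) =
      ε * ⟪Q f, f⟫ - 2 * ⟪Q f, h⟫ + ε⁻¹ * ⟪Q h, h⟫ := by field_simp; ring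
  rw [e, abs_le]
  constructor <;> nlinarith

theorem tendsto_integral_sq_of_tendsto_eLpNorm {α : Type*} {mα : MeasurableSpace α}
    {μ : Measure α} {x : ℕ → α → ℝ} (hx : ∀ n, MemLp (x n) 2 μ)
    (h : Tendsto (fun n => eLpNorm (x n) 2 μ) atTop (𝓝 0)) :
    Tendsto (fun n => ∫ a, x n a ^ 2 ∂μ) atTop (𝓝 0) := by
  have h1 : Tendsto (fun n => (eLpNorm (x n) 2 μ).toReal ^ 2) atTop (𝓝 0) := by
    simpa using ((ENNReal.tendsto_toReal ENNReal.zero_ne_top).comp h).pow 2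
  refine h1.congr fun n => ?_
  have h0 : 0 ≤ ∫ a, x n a ^ 2 ∂μ := integral_nonneg fun a => sq_nonneg _
  rw [(hx n).eLpNorm_eq_integral_rpow_norm two_ne_zero ENNReal.ofNat_ne_top]
  simp only [ENNReal.toReal_ofNat, Real.rpow_ofNat, Real.norm_eq_abs, sq_abs]
  rw [ENNReal.toReal_ofReal (by positivity), ← Real.rpow_mul_natCast h0]
  norm_num

/-! ### Step functions -/

namespace StepFunction

section

variable {U : Type*} {t : ℝ≥0}

theorem τ_le_τ (g : StepFunction U t) (i : Fin g.n) : g.τ i.castSucc ≤ g.τ i.succ :=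
  g.mono i.castSucc_le_succ

theorem τ_succ_le_τ_of_lt (g : StepFunction U t) {i j : Fin g.n} (hij : i < j) :
    g.τ i.succ ≤ g.τ j.castSucc :=
  g.mono (Fin.succ_le_castSucc_iff.2 hij)

theorem disjoint_Ioc (g : StepFunction U t) {i j : Fin g.n} (hij : i ≠ j) :
    Disjoint (Set.Ioc (g.τ i.castSucc : ℝ) (g.τ i.succ))
      (Set.Ioc (g.τ j.castSucc : ℝ) (g.τ j.succ)) := by
  rw [Set.disjoint_left]
  rintro x ⟨h1, h2⟩ ⟨h3, h4⟩
  rcases lt_or_gt_of_ne hij with h | h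
  · have := NNReal.coe_le_coe.2 (g.τ_succ_le_τ_of_lt h)
    linarith
  · have := NNReal.coe_le_coe.2 (g.τ_succ_le_τ_of_lt h)
    linarith

theorem Ioc_subset (g : StepFunction U t) (i : Fin g.n) :
    Set.Ioc (g.τ i.castSucc : ℝ) (g.τ i.succ) ⊆ Set.Ioc (0 : ℝ) t := by
  have h1 : g.τ i.succ ≤ t := (g.mono (Fin.le_last _)).trans_eq g.τ_last
  exact Set.Ioc_subset_Ioc (NNReal.coe_nonneg _) (NNReal.coe_le_coe.2 h1)

end

section

variable {U : Type*} [NormedAddCommGroup U] {t : ℝ≥0}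

theorem stronglyMeasurable_toFun (g : StepFunction U t) : StronglyMeasurable g.toFun := by
  unfold toFun
  exact Finset.stronglyMeasurable_fun_sum _ fun i _ =>
    stronglyMeasurable_const.indicator measurableSet_Ioc

theorem norm_toFun_le (g : StepFunction U t) (s : ℝ) : ‖g.toFun s‖ ≤ ∑ i, ‖g.val i‖ :=
  (norm_sum_le _ _).trans (Finset.sum_le_sum fun _ _ => norm_indicator_le_norm_self _ _)

end

end StepFunction

/-! ### Moments of the increments of a `Q`-Wiener process -/

section Wiener

variable {U : Type*} [NormedAddCommGroup U] [InnerProductSpace ℝ U] {Ω : Type*}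
  {mΩ : MeasurableSpace Ω} {P : Measure Ω} {ℱ : Filtration ℝ≥0 mΩ} {Q : U →L[ℝ] U}
  {W : ℝ≥0 → U → Ω → ℝ}

namespace IsQWiener

theorem memLp_increment (hW : IsQWiener Q ℱ P W) {s t : ℝ≥0} (hst : s ≤ t) (φ : U) :
    MemLp (fun ω => W t φ ω - W s φ ω) 2 P := by
  have h := hW.law_increment s t hst φ
  have h1 := memLp_id_gaussianReal (μ := 0) (v := (t - s) * Real.toNNReal ⟪Q φ, φ⟫) 2
  rw [← h.map_eq] at h1
  exact (memLp_map_measure_iff aestronglyMeasurable_id h.aemeasurable).1 h1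

theorem integral_increment (hW : IsQWiener Q ℱ P W) {s t : ℝ≥0} (hst : s ≤ t) (φ : U) :
    ∫ ω, (W t φ ω - W s φ ω) ∂P = 0 :=
  (hW.law_increment s t hst φ).integral_eq.trans integral_id_gaussianReal

theorem integral_sq_increment (hW : IsQWiener Q ℱ P W) (hQ : Q.IsPositive) {s t : ℝ≥0}
    (hst : s ≤ t) (φ : U) :
    ∫ ω, (W t φ ω - W s φ ω) ^ 2 ∂P = ((t : ℝ) - s) * ⟪Q φ, φ⟫ := by
  have h := hW.law_increment s t hst φ
  have h1 := h.variance_eq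
  rw [variance_id_gaussianReal,
    variance_of_integral_eq_zero h.aemeasurable (hW.integral_increment hst φ)] at h1
  rw [h1, NNReal.coe_mul, NNReal.coe_sub hst, Real.coe_toNNReal _ (hQ.inner_nonneg_left φ)]

/-- The increment is independent of the past and centred, so the expectation factors and vanishes.
This gives both the orthogonality of distinct increments and the decorrelation from the initial
data. -/
theorem integral_mul_increment [IsProbabilityMeasure P] (hW : IsQWiener Q ℱ P W) {s t : ℝ≥0}
    (hst : s ≤ t) (φ : U) {ξ : Ω → ℝ} (hξ : AEStronglyMeasurable[ℱ s] ξ P) :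
    ∫ ω, ξ ω * (W t φ ω - W s φ ω) ∂P = 0 := by
  obtain ⟨η, hη, hξη⟩ := hξ
  have hc : ∫ ω, ξ ω * (W t φ ω - W s φ ω) ∂P = ∫ ω, η ω * (W t φ ω - W s φ ω) ∂P :=
    integral_congr_ae (by filter_upwards [hξη] with ω h; rw [h])
  have hind : IndepFun η (fun ω => W t φ ω - W s φ ω) P := by
    rw [IndepFun_iff_Indep]
    refine indep_of_indep_of_le_left (indep_of_indep_of_le_right
      (hW.indep_increment s t hst).symm ?_) hη.measurable.comap_le
    rw [← measurable_iff_comap_le]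
    -- Independence is assumed for the whole family of increments; evaluation at `φ` extracts a
    -- single one.
    exact (measurable_pi_apply φ).comp
      (comap_measurable (fun ω (φ : U) => W t φ ω - W s φ ω))
  rw [hc, hind.integral_fun_mul_eq_mul_integral (hη.mono (ℱ.le s)).aestronglyMeasurable
    (hW.memLp_increment hst φ).1, hW.integral_increment hst φ, mul_zero]

end IsQWiener

/-! ### Moments of the elementary integrals -/

namespace StepFunction

variable {t : ℝ≥0}

/-- The intervals are disjoint, so at each time at most one summand is nonzero and mixed terms
vanish. -/
theorem quadratic_toFun (Q : U →L[ℝ] U) (g : StepFunction U t) (s : ℝ) :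
    ⟪Q (g.toFun s), g.toFun s⟫ = ∑ i, (Set.Ioc (g.τ i.castSucc : ℝ) (g.τ i.succ)).indicator
      (fun _ => ⟪Q (g.val i), g.val i⟫) s := by
  simp only [toFun, map_sum, sum_inner, inner_sum]
  refine Finset.sum_congr rfl fun i _ => ?_
  rw [Finset.sum_eq_single i]
  · by_cases h : s ∈ Set.Ioc (g.τ i.castSucc : ℝ) (g.τ i.succ) <;> simp [h]
  · intro j _ hji
    by_cases h : s ∈ Set.Ioc (g.τ i.castSucc : ℝ) (g.τ i.succ)
    · have h' := Set.disjoint_left.1 (g.disjoint_Ioc hji.symm) h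
      simp [h']
    · simp [h]
  · simp

theorem integral_quadratic_toFun (Q : U →L[ℝ] U) (g : StepFunction U t) :
    ∫ s in Set.Ioc (0 : ℝ) t, ⟪Q (g.toFun s), g.toFun s⟫ =
      ∑ i, ((g.τ i.succ : ℝ) - g.τ i.castSucc) * ⟪Q (g.val i), g.val i⟫ := by
  simp only [quadratic_toFun]
  rw [integral_finsetSum]
  · refine Finset.sum_congr rfl fun i _ => ?_
    rw [integral_indicator measurableSet_Ioc, Measure.restrict_restrict measurableSet_Ioc,
      Set.inter_eq_left.2 (g.Ioc_subset i), setIntegral_const, Real.volume_real_Ioc_of_le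
      (NNReal.coe_le_coe.2 (g.τ_le_τ i)), smul_eq_mul]
  · intro i _
    exact (integrable_const _).indicator measurableSet_Ioc

theorem memLp_wienerSum (hW : IsQWiener Q ℱ P W) (g : StepFunction U t) :
    MemLp (g.wienerSum W) 2 P :=
  memLp_finsetSum _ fun i _ => hW.memLp_increment (g.τ_le_τ i) (g.val i)

theorem integral_mul_wienerSum [IsProbabilityMeasure P] (hW : IsQWiener Q ℱ P W)
    (g : StepFunction U t) {ξ : Ω → ℝ} (hξ : AEStronglyMeasurable[ℱ 0] ξ P) (hξ2 : MemLp ξ 2 P) :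
    ∫ ω, ξ ω * g.wienerSum W ω ∂P = 0 := by
  simp only [wienerSum, Finset.mul_sum]
  rw [integral_finsetSum]
  · exact Finset.sum_eq_zero fun i _ => hW.integral_mul_increment (g.τ_le_τ i) _
      (hξ.mono (ℱ.mono zero_le))
  · exact fun i _ => hξ2.integrable_mul (hW.memLp_increment (g.τ_le_τ i) (g.val i))

/-- Itô isometry for step functions: of two increments the earlier is measurable at the time where
the later starts, so only the diagonal of the squared sum survives. -/
theorem integral_sq_wienerSum [IsProbabilityMeasure P] (hW : IsQWiener Q ℱ P W)
    (hQ : Q.IsPositive) (g : StepFunction U t) :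
    ∫ ω, g.wienerSum W ω ^ 2 ∂P =
      ∑ i, ((g.τ i.succ : ℝ) - g.τ i.castSucc) * ⟪Q (g.val i), g.val i⟫ := by
  have hL : ∀ i, MemLp (fun ω => W (g.τ i.succ) (g.val i) ω - W (g.τ i.castSucc) (g.val i) ω) 2 P :=
    fun i => hW.memLp_increment (g.τ_le_τ i) (g.val i)
  have hlt : ∀ i j, i < j → ∫ ω, (W (g.τ i.succ) (g.val i) ω - W (g.τ i.castSucc) (g.val i) ω) *
      (W (g.τ j.succ) (g.val j) ω - W (g.τ j.castSucc) (g.val j) ω) ∂P = 0 := fun i j hij => by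
    refine hW.integral_mul_increment (g.τ_le_τ j) _ ?_
    have h1 := (hW.adapted (g.τ i.succ) (g.val i)).mono (ℱ.mono (g.τ_succ_le_τ_of_lt hij)) le_rfl
    have h2 := (hW.adapted (g.τ i.castSucc) (g.val i)).mono
      (ℱ.mono ((g.τ_le_τ i).trans (g.τ_succ_le_τ_of_lt hij))) le_rfl
    exact (h1.sub h2).stronglyMeasurable.aestronglyMeasurable
  have hint : ∀ i j, Integrable (fun ω => (W (g.τ i.succ) (g.val i) ω -
      W (g.τ i.castSucc) (g.val i) ω) *
      (W (g.τ j.succ) (g.val j) ω - W (g.τ j.castSucc) (g.val j) ω)) P :=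
    fun i j => (hL i).integrable_mul (hL j)
  simp only [wienerSum, sq, Finset.sum_mul_sum]
  rw [integral_finsetSum _ fun i _ => integrable_finsetSum _ fun j _ => hint i j]
  refine Finset.sum_congr rfl fun i _ => ?_
  rw [integral_finsetSum _ fun j _ => hint i j, Finset.sum_eq_single i]
  · simp only [← sq]
    exact hW.integral_sq_increment hQ (g.τ_le_τ i) _
  · intro j _ hji
    rcases lt_or_gt_of_ne hji with h | h
    · simp only [mul_comm (W (g.τ i.succ) (g.val i) _ - W (g.τ i.castSucc) (g.val i) _)]
      exact hlt j i h
    · exact hlt i j h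
  · simp

end StepFunction

/-! ### The Itô isometry for the Wiener integral -/

namespace IsScalarWienerIntegral

variable {t : ℝ≥0} {f : ℝ → U} {I : Ω → ℝ}

/-- The identity holds for every elementary integral, and `L₂(Ω)` convergence preserves it. -/
theorem integral_mul_eq_zero [IsProbabilityMeasure P] (hW : IsQWiener Q ℱ P W)
    (hI : IsScalarWienerIntegral Q P W t f I) {ξ : Ω → ℝ}
    (hξ : AEStronglyMeasurable[ℱ 0] ξ P) (hξ2 : MemLp ξ 2 P) :
    ∫ ω, ξ ω * I ω ∂P = 0 := by
  obtain ⟨hI2, g, -, hg⟩ := hI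
  have hS := fun n => (g n).memLp_wienerSum hW
  refine tendsto_nhds_unique (tendsto_integral_of_abs_sub_le
    (x := fun n ω => ξ ω * (g n).wienerSum W ω) (y := fun ω => ξ ω ^ 2)
    (d := fun n ω => ((g n).wienerSum W ω - I ω) ^ 2) (fun n => hξ2.integrable_mul (hS n))
    (hξ2.integrable_mul hI2) (fun n => ((hS n).sub hI2).integrable_sq) hξ2.integrable_sq
    (fun ε hε => ⟨ε⁻¹, fun n ω => ?_⟩)
    (tendsto_integral_sq_of_tendsto_eLpNorm (fun n => (hS n).sub hI2) hg)) ?_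
  · rw [← mul_sub]
    exact abs_mul_le_sq_add_sq hε _ _
  · simp only [(g _).integral_mul_wienerSum hW hξ hξ2]
    exact tendsto_const_nhds

theorem integrable_quadratic {μ : Measure ℝ} [IsFiniteMeasure μ] (Q : U →L[ℝ] U) {h : ℝ → U}
    (hm : AEStronglyMeasurable h μ) {C : ℝ} (hC : ∀ᵐ s ∂μ, ‖h s‖ ≤ C) :
    Integrable (fun s => ⟪Q (h s), h s⟫) μ := by
  refine Integrable.of_bound ((Q.continuous.comp_aestronglyMeasurable hm).inner hm)
    (‖Q‖ * C * C) ?_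
  filter_upwards [hC] with s hs
  have h0 : 0 ≤ C := (norm_nonneg _).trans hs
  refine (norm_inner_le_norm _ _).trans ?_
  gcongr
  exact (Q.le_opNorm _).trans (by gcongr)

/-- Both sides are limits of the same numbers, by the isometry for step functions. The integrands
converge only in the seminorm of `Q`, which is all that `abs_sub_quadratic_le` requires. -/
theorem integral_sq_eq [IsProbabilityMeasure P] (hW : IsQWiener Q ℱ P W) (hQ : Q.IsPositive)
    (hf : Continuous f) (hI : IsScalarWienerIntegral Q P W t f I) :
    ∫ ω, I ω ^ 2 ∂P = ∫ s in Set.Ioc (0 : ℝ) t, ⟪Q (f s), f s⟫ := by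
  obtain ⟨hI2, g, hgf, hg⟩ := hI
  have hS := fun n => (g n).memLp_wienerSum hW
  have h1 : Tendsto (fun n => ∫ ω, (g n).wienerSum W ω ^ 2 ∂P) atTop (𝓝 (∫ ω, I ω ^ 2 ∂P)) := by
    refine tendsto_integral_of_abs_sub_le
      (x := fun n ω => (g n).wienerSum W ω ^ 2) (y := fun ω => I ω ^ 2)
      (d := fun n ω => ((g n).wienerSum W ω - I ω) ^ 2) (fun n => (hS n).integrable_sq)
      hI2.integrable_sq (fun n => ((hS n).sub hI2).integrable_sq) hI2.integrable_sq
      (fun ε hε => ⟨1 + ε⁻¹, fun n ω => ?_⟩)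
      (tendsto_integral_sq_of_tendsto_eLpNorm (fun n => (hS n).sub hI2) hg)
    -- The square is the quadratic form of the identity on `ℝ`.
    have := abs_sub_quadratic_le (ContinuousLinearMap.isPositive_one (𝕜 := ℝ) (E := ℝ)) hε (I ω)
      ((g n).wienerSum W ω)
    simpa [sq] using this
  obtain ⟨C, hC⟩ := (isCompact_Icc (a := (0 : ℝ)) (b := t)).exists_bound_of_continuousOn
    hf.continuousOn
  have hfm : AEStronglyMeasurable f (volume.restrict (Set.Ioc (0 : ℝ) t)) :=
    hf.aestronglyMeasurable
  have hfC : ∀ᵐ s ∂(volume.restrict (Set.Ioc (0 : ℝ) t)), ‖f s‖ ≤ C :=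
    (ae_restrict_iff' measurableSet_Ioc).2
      (Eventually.of_forall fun s hs => hC s (Set.Ioc_subset_Icc_self hs))
  have hgm : ∀ n, AEStronglyMeasurable (g n).toFun (volume.restrict (Set.Ioc (0 : ℝ) t)) :=
    fun n => (g n).stronglyMeasurable_toFun.aestronglyMeasurable
  have hd : ∀ n, Integrable (fun s => ⟪Q ((g n).toFun s - f s), (g n).toFun s - f s⟫)
      (volume.restrict (Set.Ioc (0 : ℝ) t)) := fun n => by
    refine integrable_quadratic Q ((hgm n).sub hfm) (C := (∑ i, ‖(g n).val i‖) + C) ?_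
    filter_upwards [hfC] with s hs
    exact (norm_sub_le _ _).trans (add_le_add ((g n).norm_toFun_le s) hs)
  have hfi := integrable_quadratic Q hfm hfC
  have h2 : Tendsto (fun n => ∫ s in Set.Ioc (0 : ℝ) t, ⟪Q ((g n).toFun s), (g n).toFun s⟫) atTop
      (𝓝 (∫ s in Set.Ioc (0 : ℝ) t, ⟪Q (f s), f s⟫)) := by
    refine tendsto_integral_of_abs_sub_le (fun n => integrable_quadratic Q (hgm n)
      (Eventually.of_forall ((g n).norm_toFun_le))) hfi hd hfi
      (fun ε hε => ⟨1 + ε⁻¹, fun n s => abs_sub_quadratic_le hQ hε _ _⟩) ?_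
    have h3 := (ENNReal.tendsto_toReal ENNReal.zero_ne_top).comp hgf
    refine h3.congr fun n => ?_
    exact (integral_eq_lintegral_of_nonneg_ae
      (Eventually.of_forall fun s => hQ.inner_nonneg_left _) (hd n).1).symm
  refine tendsto_nhds_unique h1 (h2.congr fun n => ?_)
  rw [(g n).integral_quadratic_toFun, (g n).integral_sq_wienerSum hW hQ]

end IsScalarWienerIntegral

end Wiener

end StochWave

noncomputable section

namespace StochWave

/-! ### Conservation of energy -/

theorem hasDerivAt_waveSemigroup {V : Type*} [NormedAddCommGroup V] [NormedSpace ℝ V]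
    [CompleteSpace V] (L : V →L[ℝ] V) (t : ℝ) :
    HasDerivAt (waveSemigroup L) (waveSystem L ∘L waveSemigroup L t) t :=
  hasDerivAt_exp_smul_const' (𝕂 := ℝ) (waveSystem L) t

theorem waveSemigroup_zero {V : Type*} [NormedAddCommGroup V] [NormedSpace ℝ V] (L : V →L[ℝ] V) :
    waveSemigroup L 0 = .id ℝ (V × V) := by
  rw [waveSemigroup, zero_smul, NormedSpace.exp_zero]
  rfl

/-- Evolution of functionals of the semigroup, in abstract form: `Ψ` may be evaluation at an initial
value or the passage to Riesz representatives. -/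
theorem hasDerivAt_map_comp_waveSemigroup {V : Type*} [NormedAddCommGroup V] [NormedSpace ℝ V]
    [CompleteSpace V] (L : V →L[ℝ] V) {F : Type*} [NormedAddCommGroup F] [NormedSpace ℝ F]
    (Ψ : StrongDual ℝ (V × V) →L[ℝ] F) (ℓ : StrongDual ℝ (V × V)) (t : ℝ) :
    HasDerivAt (fun r => Ψ (ℓ ∘L waveSemigroup L r))
      (Ψ ((ℓ ∘L waveSystem L) ∘L waveSemigroup L t)) t :=
  (Ψ ∘L ContinuousLinearMap.compL ℝ (V × V) (V × V) ℝ ℓ).hasFDerivAt.comp_hasDerivAt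
    t (hasDerivAt_waveSemigroup L t)

/-- The Riesz representative of `ℓ ∘ N`, as a function of the functional `ℓ`. -/
def rieszComp {U H : Type*} [NormedAddCommGroup U] [InnerProductSpace ℝ U] [CompleteSpace U]
    [NormedAddCommGroup H] [NormedSpace ℝ H] [FiniteDimensional ℝ H] (N : U →L[ℝ] H) :
    StrongDual ℝ H →L[ℝ] U :=
  LinearMap.toContinuousLinearMap
    { toFun := fun ℓ => (InnerProductSpace.toDual ℝ U).symm (ℓ ∘L N)
      map_add' := fun ℓ ℓ' => by rw [ContinuousLinearMap.add_comp, map_add]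
      map_smul' := fun c ℓ => by rw [ContinuousLinearMap.smul_comp, map_smulₛₗ]; rfl }

/-- The energy of the oscillator `f'' = -lam f`, measured by a symmetric form, is conserved. -/
theorem oscillator_energy_const {U : Type*} [NormedAddCommGroup U] [InnerProductSpace ℝ U]
    {Q : U →L[ℝ] U} (hQ : Q.IsPositive) {lam : ℝ} {f g : ℝ → U}
    (hf : ∀ r, HasDerivAt f (g r) r) (hg : ∀ r, HasDerivAt g (-(lam • f r)) r) (r : ℝ) :
    lam * ⟪Q (f r), f r⟫ + ⟪Q (g r), g r⟫ = lam * ⟪Q (f 0), f 0⟫ + ⟪Q (g 0), g 0⟫ := by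
  have hd : ∀ r, HasDerivAt (fun r => lam * ⟪Q (f r), f r⟫ + ⟪Q (g r), g r⟫) 0 r := fun r => by
    have h1 := ((Q.hasFDerivAt.comp_hasDerivAt r (hf r)).inner ℝ (hf r)).const_mul lam
    have h2 := (Q.hasFDerivAt.comp_hasDerivAt r (hg r)).inner ℝ (hg r)
    refine (h1.add h2).congr_deriv ?_
    -- By symmetry of `Q` the derivative is `2 * lam * ⟪Q f, g⟫ - 2 * lam * ⟪Q g, f⟫ = 0`.
    have hs : ⟪Q (f r), g r⟫ = ⟪Q (g r), f r⟫ := by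
      rw [hQ.inner_left_eq_inner_right, real_inner_comm]
    simp only [Function.comp_apply, map_neg, map_smul, inner_neg_left, inner_neg_right,
      real_inner_smul_left, real_inner_smul_right, hs]
    ring
  exact is_const_of_deriv_eq_zero (fun r => (hd r).differentiableAt) (fun r => (hd r).deriv) r 0

/-! ### The trace of a compression to a finite dimensional subspace -/

/-- Parseval in the finite basis `b` writes each diagonal entry as a finite sum over `i`; Parseval
in `e` then sums each of these terms over `k`. The result does not involve `e`. -/
theorem hasTrace_starProjection_comp {U : Type*} [NormedAddCommGroup U] [InnerProductSpace ℝ U]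
    {ι : Type*} [Fintype ι] (K : Submodule ℝ U) [K.HasOrthogonalProjection] (Q : U →L[ℝ] U)
    (hQ : Q.IsPositive) (b : OrthonormalBasis ι ℝ K) :
    HasTrace (K.starProjection ∘L Q ∘L K.starProjection) (∑ i, ⟪Q (b i : U), (b i : U)⟫) := by
  intro w e
  have h : ∀ i, HasSum (fun k => ⟪K.starProjection (Q (b i : U)), e k⟫ * ⟪e k, (b i : U)⟫)
      ⟪Q (b i : U), (b i : U)⟫ := fun i => by
    have h1 : ⟪K.starProjection (Q (b i : U)), (b i : U)⟫ = ⟪Q (b i : U), (b i : U)⟫ :=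
      K.inner_orthogonalProjectionOnto_eq_of_mem_right (b i) _
    rw [← h1]
    exact e.hasSum_inner_mul_inner _ _
  convert hasSum_sum (s := Finset.univ) fun i _ => h i using 2 with k
  have h1 : ⟪e k, (K.starProjection ∘L Q ∘L K.starProjection) (e k)⟫ =
      ⟪K.orthogonalProjectionOnto (e k), K.orthogonalProjectionOnto (Q (K.starProjection (e k)))⟫ :=
    (K.inner_orthogonalProjectionOnto_eq_of_mem_right
      (K.orthogonalProjectionOnto (Q (K.starProjection (e k)))) (e k)).symm
  rw [h1, ← b.sum_inner_mul_inner]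
  refine Finset.sum_congr rfl fun i _ => ?_
  rw [mul_comm]
  congr 1
  · rw [K.inner_orthogonalProjectionOnto_eq_of_mem_left, ← hQ.inner_left_eq_inner_right]
    exact K.inner_starProjection_left_eq_right _ _ |>.symm
  · exact K.inner_orthogonalProjectionOnto_eq_of_mem_right (b i) (e k)

namespace Triangulation

variable {d : ℕ} {D : Opens (EuclideanSpace ℝ (Fin d))} (𝒯 : Triangulation D)

/-! ### Eigencoordinates -/

/-- Makes the eigenvalues nonnegative, so that their real powers `1 / 2` square back to them. -/
theorem isPositive_discreteLaplacian : 𝒯.discreteLaplacian.IsPositive := by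
  refine ⟨𝒯.isSymmetric_discreteLaplacian, fun v => ?_⟩
  rw [inner_discreteLaplacian]
  exact integral_nonneg fun x => real_inner_self_nonneg

/-- An orthonormal basis of eigenvectors of the discrete Laplacian. -/
def eigenbasis : OrthonormalBasis (Fin (Module.finrank ℝ 𝒯.Vh)) ℝ 𝒯.Vh :=
  𝒯.isSymmetric_discreteLaplacian.eigenvectorBasis rfl

/-- The eigenvalues of the discrete Laplacian. -/
def eigenvalue (i : Fin (Module.finrank ℝ 𝒯.Vh)) : ℝ :=
  𝒯.isSymmetric_discreteLaplacian.eigenvalues rfl i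

theorem eigenvalue_nonneg (i : Fin (Module.finrank ℝ 𝒯.Vh)) : 0 ≤ 𝒯.eigenvalue i :=
  𝒯.isPositive_discreteLaplacian.nonneg_eigenvalues rfl i

theorem inner_eigenbasis_discreteLaplacian (i : Fin (Module.finrank ℝ 𝒯.Vh)) (v : 𝒯.Vh) :
    ⟪𝒯.eigenbasis i, 𝒯.discreteLaplacian v⟫ = 𝒯.eigenvalue i * ⟪𝒯.eigenbasis i, v⟫ := by
  rw [← 𝒯.isSymmetric_discreteLaplacian, ← real_inner_smul_left]
  congr 1
  exact 𝒯.isSymmetric_discreteLaplacian.apply_eigenvectorBasis rfl i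

/-- The `i`-th eigencoordinate of the displacement. -/
def coordFst (i : Fin (Module.finrank ℝ 𝒯.Vh)) : StrongDual ℝ (𝒯.Vh × 𝒯.Vh) :=
  innerSL ℝ (𝒯.eigenbasis i) ∘L ContinuousLinearMap.fst ℝ 𝒯.Vh 𝒯.Vh

/-- The `i`-th eigencoordinate of the velocity. -/
def coordSnd (i : Fin (Module.finrank ℝ 𝒯.Vh)) : StrongDual ℝ (𝒯.Vh × 𝒯.Vh) :=
  innerSL ℝ (𝒯.eigenbasis i) ∘L ContinuousLinearMap.snd ℝ 𝒯.Vh 𝒯.Vh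

theorem energy_eq_sum (u : 𝒯.Vh × 𝒯.Vh) : 𝒯.energy u =
    1 / 2 * ∑ i, (𝒯.eigenvalue i * 𝒯.coordFst i u ^ 2 + 𝒯.coordSnd i u ^ 2) := by
  have h1 : ‖𝒯.discreteLaplacianPow (1 / 2) u.1‖ ^ 2 =
      ∑ i, 𝒯.eigenvalue i * 𝒯.coordFst i u ^ 2 := by
    have : 𝒯.discreteLaplacianPow (1 / 2) u.1 =
        ∑ i, (𝒯.eigenvalue i ^ (1 / 2 : ℝ) * 𝒯.coordFst i u) • 𝒯.eigenbasis i :=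
      Finset.sum_congr rfl fun i _ => smul_smul _ _ _
    rw [this, ← real_inner_self_eq_norm_sq, 𝒯.eigenbasis.orthonormal.inner_sum]
    refine Finset.sum_congr rfl fun i _ => ?_
    have h2 : 𝒯.eigenvalue i ^ (1 / 2 : ℝ) * 𝒯.eigenvalue i ^ (1 / 2 : ℝ) = 𝒯.eigenvalue i := by
      rw [← Real.sqrt_eq_rpow, Real.mul_self_sqrt (𝒯.eigenvalue_nonneg i)]
    rw [conj_trivial]
    linear_combination 𝒯.coordFst i u ^ 2 * h2
  have h2 : ‖u.2‖ ^ 2 = ∑ i, 𝒯.coordSnd i u ^ 2 := by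
    rw [← 𝒯.eigenbasis.sum_sq_norm_inner_right]
    refine Finset.sum_congr rfl fun i _ => ?_
    rw [Real.norm_eq_abs, sq_abs]
    rfl
  rw [energy, h1, h2, Finset.sum_add_distrib]

/-- The modes decouple: symmetry moves the Laplacian onto its eigenvector. -/
theorem coordSnd_waveSystem (i : Fin (Module.finrank ℝ 𝒯.Vh)) :
    𝒯.coordSnd i ∘L waveSystem (LinearMap.toContinuousLinearMap 𝒯.discreteLaplacian) =
      -(𝒯.eigenvalue i • 𝒯.coordFst i) := by
  refine ContinuousLinearMap.ext fun u => ?_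
  change ⟪𝒯.eigenbasis i, -𝒯.discreteLaplacian u.1⟫ = -(𝒯.eigenvalue i * ⟪𝒯.eigenbasis i, u.1⟫)
  rw [inner_neg_right, inner_eigenbasis_discreteLaplacian]

/-- Leaving `Ψ` free lets one oscillator argument cover both the deterministic energy and the Itô
integrand. -/
theorem eigencoordinate_energy_const {F : Type*} [NormedAddCommGroup F] [InnerProductSpace ℝ F]
    {Q : F →L[ℝ] F} (hQ : Q.IsPositive) (Ψ : StrongDual ℝ (𝒯.Vh × 𝒯.Vh) →L[ℝ] F)
    (i : Fin (Module.finrank ℝ 𝒯.Vh)) (t : ℝ) :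
    𝒯.eigenvalue i * ⟪Q (Ψ (𝒯.coordFst i ∘L 𝒯.semigroup t)), Ψ (𝒯.coordFst i ∘L 𝒯.semigroup t)⟫ +
      ⟪Q (Ψ (𝒯.coordSnd i ∘L 𝒯.semigroup t)), Ψ (𝒯.coordSnd i ∘L 𝒯.semigroup t)⟫ =
    𝒯.eigenvalue i * ⟪Q (Ψ (𝒯.coordFst i)), Ψ (𝒯.coordFst i)⟫ +
      ⟪Q (Ψ (𝒯.coordSnd i)), Ψ (𝒯.coordSnd i)⟫ := by
  have h0 : 𝒯.semigroup 0 = .id ℝ (𝒯.Vh × 𝒯.Vh) := waveSemigroup_zero _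
  have h := oscillator_energy_const hQ (lam := 𝒯.eigenvalue i)
    (f := fun r => Ψ (𝒯.coordFst i ∘L 𝒯.semigroup r))
    (g := fun r => Ψ (𝒯.coordSnd i ∘L 𝒯.semigroup r))
    -- The relation `f' = g` needs no rewriting: `coordFst` after the block operator is `coordSnd`
    -- by definition.
    (fun r => hasDerivAt_map_comp_waveSemigroup _ Ψ _ r)
    (fun r => (hasDerivAt_map_comp_waveSemigroup _ Ψ _ r).congr_deriv (by
      rw [coordSnd_waveSystem, ContinuousLinearMap.neg_comp, ContinuousLinearMap.smul_comp,
        map_neg, map_smul]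
      rfl)) t
  simpa only [h0, ContinuousLinearMap.comp_id] using h

theorem energy_semigroup (t : ℝ) (u : 𝒯.Vh × 𝒯.Vh) :
    𝒯.energy (𝒯.semigroup t u) = 𝒯.energy u := by
  rw [energy_eq_sum, energy_eq_sum]
  congr 1
  refine Finset.sum_congr rfl fun i _ => ?_
  have := 𝒯.eigencoordinate_energy_const (ContinuousLinearMap.isPositive_one (𝕜 := ℝ) (E := ℝ))
    (ContinuousLinearMap.apply ℝ ℝ u) i t
  simpa [sq] using this

/-! ### Energies of the noise -/

/-- The Riesz representative in `L₂(D)` of `ℓ ∘ P_h B`. -/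
def noiseDual : StrongDual ℝ (𝒯.Vh × 𝒯.Vh) →L[ℝ] L2 D :=
  rieszComp 𝒯.noiseOp

theorem inner_noiseDual (ℓ : StrongDual ℝ (𝒯.Vh × 𝒯.Vh)) (φ : L2 D) :
    ⟪𝒯.noiseDual ℓ, φ⟫ = ℓ (𝒯.noiseOp φ) :=
  InnerProductSpace.toDual_symm_apply (𝕜 := ℝ) (y := ℓ ∘L 𝒯.noiseOp)

theorem noiseDual_coordFst (i : Fin (Module.finrank ℝ 𝒯.Vh)) :
    𝒯.noiseDual (𝒯.coordFst i) = 0 :=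
  ext_inner_right ℝ fun φ => by
    rw [inner_noiseDual, inner_zero_left]
    exact inner_zero_right (𝕜 := ℝ) (𝒯.eigenbasis i)

theorem noiseDual_coordSnd (i : Fin (Module.finrank ℝ 𝒯.Vh)) :
    𝒯.noiseDual (𝒯.coordSnd i) = 𝒯.eigenbasis i :=
  ext_inner_right ℝ fun φ => by
    rw [inner_noiseDual]
    exact 𝒯.Vh.inner_orthogonalProjectionOnto_eq_of_mem_left _ _

/-- Conservation moves the evaluation to time zero, where the displacement part carries no noise.
The rate of energy input is therefore independent of time. -/
theorem noise_energy (Q : L2 D →L[ℝ] L2 D) (hQ : Q.IsPositive)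
    (i : Fin (Module.finrank ℝ 𝒯.Vh)) (t : ℝ) :
    𝒯.eigenvalue i * ⟪Q (𝒯.noiseDual (𝒯.coordFst i ∘L 𝒯.semigroup t)),
        𝒯.noiseDual (𝒯.coordFst i ∘L 𝒯.semigroup t)⟫ +
      ⟪Q (𝒯.noiseDual (𝒯.coordSnd i ∘L 𝒯.semigroup t)),
        𝒯.noiseDual (𝒯.coordSnd i ∘L 𝒯.semigroup t)⟫ =
    ⟪Q (𝒯.eigenbasis i), (𝒯.eigenbasis i : L2 D)⟫ := by
  rw [𝒯.eigencoordinate_energy_const hQ, noiseDual_coordFst, noiseDual_coordSnd]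
  simp

theorem continuous_noiseDual_comp_semigroup (ℓ : StrongDual ℝ (𝒯.Vh × 𝒯.Vh)) (t : ℝ) :
    Continuous fun s => 𝒯.noiseDual (ℓ ∘L 𝒯.semigroup (t - s)) := by
  have h : Continuous fun r => 𝒯.noiseDual (ℓ ∘L 𝒯.semigroup r) :=
    continuous_iff_continuousAt.2 fun r =>
      (hasDerivAt_map_comp_waveSemigroup _ 𝒯.noiseDual ℓ r).continuousAt
  exact h.comp (continuous_const.sub continuous_id)

/-! ### The stochastic evolution -/

section Evolution

variable {Ω : Type*} {mΩ : MeasurableSpace Ω} {P : Measure Ω}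

/-- Square integrability is asked of functionals because the Wiener integral is specified through
them. -/
theorem integrable_energy {Y : Ω → 𝒯.Vh × 𝒯.Vh}
    (hY : ∀ ℓ : StrongDual ℝ (𝒯.Vh × 𝒯.Vh), MemLp (fun ω => ℓ (Y ω)) 2 P) :
    Integrable (fun ω => 𝒯.energy (Y ω)) P := by
  simp only [energy_eq_sum]
  exact (integrable_finsetSum _ fun i _ =>
    ((hY (𝒯.coordFst i)).integrable_sq.const_mul _).add (hY (𝒯.coordSnd i)).integrable_sq).const_mul _

theorem integral_energy {Y : Ω → 𝒯.Vh × 𝒯.Vh}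
    (hY : ∀ ℓ : StrongDual ℝ (𝒯.Vh × 𝒯.Vh), MemLp (fun ω => ℓ (Y ω)) 2 P) :
    ∫ ω, 𝒯.energy (Y ω) ∂P = 1 / 2 * ∑ i, (𝒯.eigenvalue i * ∫ ω, 𝒯.coordFst i (Y ω) ^ 2 ∂P +
      ∫ ω, 𝒯.coordSnd i (Y ω) ^ 2 ∂P) := by
  have h1 := fun i => (hY (𝒯.coordFst i)).integrable_sq.const_mul (𝒯.eigenvalue i)
  have h2 := fun i => (hY (𝒯.coordSnd i)).integrable_sq
  have h12 : ∀ i, Integrable (fun ω => 𝒯.eigenvalue i * 𝒯.coordFst i (Y ω) ^ 2 +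
      𝒯.coordSnd i (Y ω) ^ 2) P := fun i => (h1 i).add (h2 i)
  simp only [energy_eq_sum]
  rw [integral_const_mul, integral_finsetSum _ fun i _ => h12 i]
  congr 1
  refine Finset.sum_congr rfl fun i _ => ?_
  rw [← integral_const_mul]
  exact integral_add (h1 i) (h2 i)

variable [IsProbabilityMeasure P] {ℱ : Filtration ℝ≥0 mΩ} {Q : L2 D →L[ℝ] L2 D}
  {W : ℝ≥0 → L2 D → Ω → ℝ}

/-- Expanding the square leaves a cross term that vanishes by independence from `ℱ 0`, and a noise
term given by the Itô isometry. -/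
theorem integral_sq_dual_add (hQ : Q.IsPositive) (hW : IsQWiener Q ℱ P W) {t : ℝ≥0}
    {I Y : Ω → 𝒯.Vh × 𝒯.Vh}
    (hI : IsWienerIntegral Q P W t (fun s => 𝒯.semigroup (t - s) ∘L 𝒯.noiseOp) I)
    (hY : AEStronglyMeasurable[ℱ 0] Y P) (hY2 : MemLp Y 2 P)
    (ℓ : StrongDual ℝ (𝒯.Vh × 𝒯.Vh)) :
    ∫ ω, ℓ (Y ω + I ω) ^ 2 ∂P = ∫ ω, ℓ (Y ω) ^ 2 ∂P +
      ∫ s in Set.Ioc (0 : ℝ) t, ⟪Q (𝒯.noiseDual (ℓ ∘L 𝒯.semigroup (t - s))),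
        𝒯.noiseDual (ℓ ∘L 𝒯.semigroup (t - s))⟫ := by
  have hYℓ : MemLp (fun ω => ℓ (Y ω)) 2 P := ℓ.comp_memLp' hY2
  have hIℓ : IsScalarWienerIntegral Q P W t
      (fun s => 𝒯.noiseDual (ℓ ∘L 𝒯.semigroup (t - s))) (fun ω => ℓ (I ω)) := hI ℓ
  have hcross := hIℓ.integral_mul_eq_zero hW (ℓ.continuous.comp_aestronglyMeasurable hY) hYℓ
  rw [← hIℓ.integral_sq_eq hW hQ (𝒯.continuous_noiseDual_comp_semigroup ℓ t)]
  have h1 : Integrable (fun ω => 2 * (ℓ (Y ω) * ℓ (I ω))) P :=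
    (hYℓ.integrable_mul hIℓ.1).const_mul 2
  have e : ∀ ω, ℓ (Y ω + I ω) ^ 2 = ℓ (Y ω) ^ 2 + 2 * (ℓ (Y ω) * ℓ (I ω)) + ℓ (I ω) ^ 2 :=
    fun ω => by rw [map_add]; ring
  simp only [e]
  have h2 : Integrable (fun ω => ℓ (Y ω) ^ 2 + 2 * (ℓ (Y ω) * ℓ (I ω))) P :=
    hYℓ.integrable_sq.add h1
  rw [integral_add h2 hIℓ.1.integrable_sq,
    integral_add hYℓ.integrable_sq h1, integral_const_mul]
  rw [hcross, mul_zero, add_zero]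

theorem integral_energy_add (hQ : Q.IsPositive) (hW : IsQWiener Q ℱ P W) {t : ℝ≥0}
    {I Y : Ω → 𝒯.Vh × 𝒯.Vh}
    (hI : IsWienerIntegral Q P W t (fun s => 𝒯.semigroup (t - s) ∘L 𝒯.noiseOp) I)
    (hY : AEStronglyMeasurable[ℱ 0] Y P) (hY2 : MemLp Y 2 P) :
    ∫ ω, 𝒯.energy (Y ω + I ω) ∂P = ∫ ω, 𝒯.energy (Y ω) ∂P +
      1 / 2 * t * ∑ i, ⟪Q (𝒯.eigenbasis i : L2 D), (𝒯.eigenbasis i : L2 D)⟫ := by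
  have hYℓ : ∀ ℓ : StrongDual ℝ (𝒯.Vh × 𝒯.Vh), MemLp (fun ω => ℓ (Y ω)) 2 P :=
    fun ℓ => ℓ.comp_memLp' hY2
  have hYI : ∀ ℓ : StrongDual ℝ (𝒯.Vh × 𝒯.Vh), MemLp (fun ω => ℓ (Y ω + I ω)) 2 P := fun ℓ => by
    simp only [map_add]
    exact (hYℓ ℓ).add (hI ℓ).1
  rw [𝒯.integral_energy hYI, 𝒯.integral_energy hYℓ, mul_assoc, ← mul_add,
    Finset.mul_sum Finset.univ _ (t : ℝ), ← Finset.sum_add_distrib]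
  congr 1
  refine Finset.sum_congr rfl fun i _ => ?_
  rw [𝒯.integral_sq_dual_add hQ hW hI hY hY2, 𝒯.integral_sq_dual_add hQ hW hI hY hY2]
  have hint : ∀ ℓ : StrongDual ℝ (𝒯.Vh × 𝒯.Vh), Integrable (fun s : ℝ =>
      ⟪Q (𝒯.noiseDual (ℓ ∘L 𝒯.semigroup (t - s))), 𝒯.noiseDual (ℓ ∘L 𝒯.semigroup (t - s))⟫)
      (volume.restrict (Set.Ioc (0 : ℝ) t)) := fun ℓ => by
    have hc := 𝒯.continuous_noiseDual_comp_semigroup ℓ t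
    exact ((Q.continuous.comp hc).inner hc).integrableOn_Ioc
  -- The two variances must be combined under the time integral: only their weighted sum is constant
  -- in `s`.
  have h : 𝒯.eigenvalue i * (∫ s in Set.Ioc (0 : ℝ) t,
        ⟪Q (𝒯.noiseDual (𝒯.coordFst i ∘L 𝒯.semigroup (t - s))),
          𝒯.noiseDual (𝒯.coordFst i ∘L 𝒯.semigroup (t - s))⟫) +
      (∫ s in Set.Ioc (0 : ℝ) t, ⟪Q (𝒯.noiseDual (𝒯.coordSnd i ∘L 𝒯.semigroup (t - s))),
        𝒯.noiseDual (𝒯.coordSnd i ∘L 𝒯.semigroup (t - s))⟫) =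
      t * ⟪Q (𝒯.eigenbasis i : L2 D), (𝒯.eigenbasis i : L2 D)⟫ := by
    rw [← integral_const_mul, ← integral_add ((hint _).const_mul _) (hint _)]
    simp only [𝒯.noise_energy Q hQ]
    rw [setIntegral_const, Real.volume_real_Ioc_of_le t.coe_nonneg, sub_zero, smul_eq_mul]
  linear_combination h

end Evolution

end Triangulation

end StochWave

end

theorem theorem5p1 {d : ℕ} (hd : 1 ≤ d ∧ d ≤ 3)
    (D : Opens (EuclideanSpace ℝ (Fin d)))
    (hDne : (D : Set (EuclideanSpace ℝ (Fin d))).Nonempty)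
    (hDconv : Convex ℝ (D : Set (EuclideanSpace ℝ (Fin d))))
    (hDbdd : Bornology.IsBounded (D : Set (EuclideanSpace ℝ (Fin d))))
    (𝒯 : Triangulation D)
    {Ω : Type*} [mΩ : MeasurableSpace Ω] (P : Measure Ω) [IsProbabilityMeasure P]
    (ℱ : Filtration ℝ≥0 mΩ)
    (Q : L2 D →L[ℝ] L2 D) (hQ : Q.IsPositive)
    (W : ℝ≥0 → L2 D → Ω → ℝ) (hW : IsQWiener Q ℱ P W)
    (u₀ v₀ : Ω → 𝒯.Vh)
    (hu₀ : AEStronglyMeasurable[ℱ 0] u₀ P) (hv₀ : AEStronglyMeasurable[ℱ 0] v₀ P)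
    (hu₀2 : MemLp u₀ 2 P) (hv₀2 : MemLp v₀ 2 P)
    (X : ℝ≥0 → Ω → 𝒯.Vh × 𝒯.Vh)
    (hX : IsSemidiscreteSolution 𝒯 Q P W (fun ω => (u₀ ω, v₀ ω)) X) :
    ∃ τ : ℝ, HasTrace (𝒯.Vh.starProjection ∘L Q ∘L 𝒯.Vh.starProjection) τ ∧
      Integrable (fun ω => 𝒯.energy (u₀ ω, v₀ ω)) P ∧
      ∀ t : ℝ≥0, Integrable (fun ω => 𝒯.energy (X t ω)) P ∧
        ∫ ω, 𝒯.energy (X t ω) ∂P = ∫ ω, 𝒯.energy (u₀ ω, v₀ ω) ∂P + 1 / 2 * t * τ := by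
  have hX₀ : MemLp (fun ω => (u₀ ω, v₀ ω)) 2 P := memLp_prod_iff.2 ⟨hu₀2, hv₀2⟩
  -- The trace is the finite sum of `⟪Q (e i), e i⟫` over the eigenbasis of the discrete Laplacian,
  -- the form in which the noise energy appears.
  refine ⟨_, hasTrace_starProjection_comp 𝒯.Vh Q hQ 𝒯.eigenbasis,
    𝒯.integrable_energy fun ℓ => ℓ.comp_memLp' hX₀, fun t => ?_⟩
  obtain ⟨I, hI, hXt⟩ := hX t
  -- The semigroup is deterministic, so the evolved initial value stays measurable with respect to
  -- `ℱ 0`.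
  have hY : AEStronglyMeasurable[ℱ 0] (fun ω => 𝒯.semigroup t (u₀ ω, v₀ ω)) P :=
    (𝒯.semigroup t).continuous.comp_aestronglyMeasurable (hu₀.prodMk hv₀)
  have hY2 : MemLp (fun ω => 𝒯.semigroup t (u₀ ω, v₀ ω)) 2 P := (𝒯.semigroup t).comp_memLp' hX₀
  have hcongr : (fun ω => 𝒯.energy (X t ω)) =ᵐ[P]
      fun ω => 𝒯.energy (𝒯.semigroup t (u₀ ω, v₀ ω) + I ω) := by
    filter_upwards [hXt] with ω h
    rw [h]
  constructor
  · refine (integrable_congr hcongr).2 (𝒯.integrable_energy fun ℓ => ?_)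
    simp only [map_add]
    exact (ℓ.comp_memLp' hY2).add (hI ℓ).1
  · rw [integral_congr_ae hcongr, 𝒯.integral_energy_add hQ hW hI hY hY2]
    simp only [𝒯.energy_semigroup]
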